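/- Let $p\geq 5$ be a prime number. A prime $\ell$ is called exceptional for $p$ if $\ell\neq p$ and there exist $u,v,w\in\mathbb{F}_\ell^*$ such that the projective curve $ux^p+vy^p+wz^p=0$ has no $\mathbb{F}_\ell$-rational point; there are only finitely many such primes. Let $N$ be the product of $p$ and all the exceptional primes for $p$. Let $r$ be a prime number such that $$r\equiv -1 \pmod N\quad\text{and}\quad r^{p-1}\not\equiv 1\pmod{p^2}.$$ For a prime number $q$, let $C_q/\mathbb{Q}$ be the projective curve $x^p+qy^p+rz^p=0$, and let $S$ be the set of prime numbers $q\not\equiv 1\pmod p$ such that $C_q$ has no local obstruction, i.e. such that $C_q(\mathbb{Q}_\ell)\neq\emptyset$ for every prime number $\ell$. Then $S$ has a Dirichlet density $d(S)$ (among the prime numbers), and $$d(S)\geq\frac{2(p-2)}{p(p-1)}.$$ -/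

import Mathlib

open scoped LinearAlgebra.Projectivization
open NumberField

/-- The set `C(K)` of `K`-rational points of the projective plane curve
`C : a x ^ n + b y ^ n + c z ^ n = 0` with coefficients in a field `k`, where `K` is an extension
of `k`. The equation is homogeneous, so it may be tested on any representative of a point
(see `mk_mem_fermatPoints`). -/
def fermatPoints {k : Type*} [Field k] (n : ℕ) (a b c : k) (K : Type*) [Field K] [Algebra k K] :
    Set (ℙ K (Fin 3 → K)) :=
  {P | algebraMap k K a * P.rep 0 ^ n + algebraMap k K b * P.rep 1 ^ n
      + algebraMap k K c * P.rep 2 ^ n = 0}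

/-- The point `[v 0, v 1, v 2]` lies on the curve if and only if `v` satisfies the equation. -/
theorem mk_mem_fermatPoints {k : Type*} [Field k] (n : ℕ) (a b c : k) (K : Type*) [Field K]
    [Algebra k K] (v : Fin 3 → K) (hv : v ≠ 0) :
    Projectivization.mk K v hv ∈ fermatPoints n a b c K ↔
      algebraMap k K a * v 0 ^ n + algebraMap k K b * v 1 ^ n + algebraMap k K c * v 2 ^ n = 0 := by
  obtain ⟨t, ht⟩ := Projectivization.exists_smul_eq_mk_rep K v hv
  have h : ∀ i, (Projectivization.mk K v hv).rep i = (t : K) * v i := by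
    intro i
    rw [← ht]
    rfl
  have ht0 : (t : K) ^ n ≠ 0 := pow_ne_zero _ t.ne_zero
  simp only [fermatPoints, Set.mem_ofPred_eq, h]
  refine Iff.trans (Eq.congr_left ?_) (mul_eq_zero.trans (or_iff_right ht0))
  ring

/-- The Fermat curve `a x ^ p + b y ^ p + c z ^ p = 0` over `ℚ` has a local obstruction at the
prime `ℓ` if it has no point over `ℚ_ℓ`. -/
def HasLocalObstruction (p : ℕ) (a b c : ℚ) (ℓ : ℕ) [Fact ℓ.Prime] : Prop :=
  fermatPoints p a b c ℚ_[ℓ] = ∅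

/-- The set `S(p)` of exceptional primes for `p`: the primes `ℓ ≠ p` such that, for some nonzero
`u, v, w` in `𝔽_ℓ`, the curve `u x ^ p + v y ^ p + w z ^ p = 0` has no point over `𝔽_ℓ`. -/
def exceptionalPrimes (p : ℕ) : Set ℕ :=
  {ℓ | ∃ _ : Fact ℓ.Prime, ℓ ≠ p ∧
    ∃ u v w : (ZMod ℓ)ˣ, fermatPoints p (u : ZMod ℓ) (v : ZMod ℓ) (w : ZMod ℓ) (ZMod ℓ) = ∅}

/-- The integer `N = p ∏ ℓ`, the product being over the (finitely many) exceptional primes `ℓ`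
for `p`. -/
noncomputable def exceptionalModulus (p : ℕ) : ℕ :=
  p * ∏ᶠ ℓ ∈ exceptionalPrimes p, ℓ

/-- The set `S` of primes `q ≢ 1 (mod p)` such that the curve
`C_q : x ^ p + q y ^ p + r z ^ p = 0` over `ℚ` has no local obstruction. -/
def unobstructedPrimes (p r : ℕ) : Set ℕ :=
  {q | q.Prime ∧ ¬ q ≡ 1 [MOD p] ∧
    ∀ (ℓ : ℕ) [Fact ℓ.Prime], ¬ HasLocalObstruction p 1 q r ℓ}

/-- A set `T` of prime numbers has Dirichlet density `d`: the quotient of `∑ q ^ (-s)` over the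
primes `q ∈ T` by `∑ q ^ (-s)` over all primes `q` tends to `d` as `s → 1⁺`. A prime number is
identified with the prime ideal of the ring of integers of `ℚ` of which it is the norm. -/
def HasPrimeDensity (T : Set ℕ) (d : ℝ) : Prop :=
  NumberField.Set.HasDirichletDensity (K := ℚ)
    {𝔮 : IsDedekindDomain.HeightOneSpectrum (𝓞 ℚ) | Ideal.absNorm 𝔮.asIdeal ∈ T} d

/-! Away from `q ∈ {p, r}`, only the prime `p` can obstruct `C_q`, and there solubility depends only
on `q` mod `p ^ 2`. So up to two primes `S` is a union of unit classes mod `p ^ 2`; Dirichlet's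
theorem gives its density as the number of classes divided by `p (p - 1)`, and at least `2 (p - 2)`
classes have to be found.

At `ℓ ≠ p` a point mod `ℓ` with suitable smoothness lifts by Hensel (`fermatSoluble_of_ne`). If `ℓ`
is `q` or `r`, it is not `1` mod `p`, so every residue mod `ℓ` is a `p`-th power. If `ℓ` is
exceptional, `r ≡ -1` mod `ℓ` and `(1 : 0 : 1)` is a point mod `ℓ`. Otherwise a point exists by
definition. That exceptional primes are finite in number, so that the modulus is a genuine product,
comes from an elementary exponential sum bound (`exists_fermat_solution_of_lt`).

At `p`, units congruent mod `p ^ 2` differ by a `p`-th power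
(`PadicInt.exists_mul_pow_eq_of_dvd_sub`). The classes `t ^ p` and `r t ^ p` are visibly soluble,
and they are distinct because `r ^ (p - 1) ≢ 1` mod `p ^ 2`
(`two_mul_sub_two_le_card_solubleClasses`). -/

/-- The curve has a `K`-point if and only if its equation has a nonzero solution in `K`. -/
theorem fermatPoints_ne_empty_iff {k : Type*} [Field k] (n : ℕ) (a b c : k) (K : Type*) [Field K]
    [Algebra k K] :
    fermatPoints n a b c K ≠ ∅ ↔ ∃ x y z : K, (x ≠ 0 ∨ y ≠ 0 ∨ z ≠ 0) ∧
      algebraMap k K a * x ^ n + algebraMap k K b * y ^ n + algebraMap k K c * z ^ n = 0 := by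
  rw [← Set.nonempty_iff_ne_empty]
  constructor
  · rintro ⟨P, hP⟩
    refine ⟨P.rep 0, P.rep 1, P.rep 2, ?_, hP⟩
    by_contra! h
    refine P.rep_nonzero (funext fun i => ?_)
    fin_cases i <;> simp [h]
  · rintro ⟨x, y, z, h, e⟩
    have hv : (![x, y, z] : Fin 3 → K) ≠ 0 := by
      intro h0
      have h1 := congrFun h0 0
      have h2 := congrFun h0 1
      have h3 := congrFun h0 2
      simp at h1 h2 h3
      simp [h1, h2, h3] at h
    exact ⟨_, (mk_mem_fermatPoints n a b c K _ hv).2 (by simpa using e)⟩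

/-! ### Exponential sums and points on diagonal curves over a finite field -/

section FermatCount

variable {ℓ : ℕ} [Fact ℓ.Prime]

/-- The exponential sum `∑ x, ψ (a x ^ p)` over `ZMod ℓ`. -/
noncomputable def powExpSum (p : ℕ) (a : ZMod ℓ) : ℂ :=
  ∑ x : ZMod ℓ, ZMod.stdAddChar (a * x ^ p)

theorem card_pow_eq_le {p : ℕ} (hp : 0 < p) (c : ZMod ℓ) :
    (Finset.univ.filter fun x : ZMod ℓ => x ^ p = c).card ≤ p := by
  classical
  refine le_trans ?_ (Polynomial.card_nthRoots p c)
  refine le_trans (Finset.card_le_card (t := (Polynomial.nthRoots p c).toFinset) ?_)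
    (Multiset.toFinset_card_le _)
  intro x hx
  simpa [Polynomial.mem_nthRoots hp] using hx

/-- Parseval: expand the square and apply orthogonality of additive characters in `a`. -/
theorem sum_norm_powExpSum_sq (p : ℕ) :
    ∑ a : ZMod ℓ, ‖powExpSum p a‖ ^ 2 =
      ℓ * ∑ y : ZMod ℓ, ((Finset.univ.filter fun x : ZMod ℓ => x ^ p = y ^ p).card : ℝ) := by
  have key : ∀ a : ZMod ℓ, ((‖powExpSum p a‖ ^ 2 : ℝ) : ℂ) =
      ∑ y : ZMod ℓ, ∑ x : ZMod ℓ, ZMod.stdAddChar (a * (x ^ p - y ^ p)) := by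
    intro a
    rw [← Complex.normSq_eq_norm_sq, ← Complex.mul_conj, powExpSum, map_sum, Finset.sum_mul_sum,
      Finset.sum_comm]
    refine Finset.sum_congr rfl fun y _ => Finset.sum_congr rfl fun x _ => ?_
    rw [← AddChar.map_neg_eq_conj, ← AddChar.map_add_eq_mul]
    congr 1
    ring
  have : ((∑ a : ZMod ℓ, ‖powExpSum p a‖ ^ 2 : ℝ) : ℂ) =
      ((ℓ * ∑ y : ZMod ℓ, ((Finset.univ.filter fun x : ZMod ℓ => x ^ p = y ^ p).card : ℝ) : ℝ)
        : ℂ) := by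
    rw [Complex.ofReal_sum]
    simp_rw [key]
    rw [Finset.sum_comm]
    push_cast
    rw [Finset.mul_sum]
    refine Finset.sum_congr rfl fun y _ => ?_
    rw [Finset.sum_comm]
    simp_rw [AddChar.sum_mulShift _ (ZMod.isPrimitive_stdAddChar ℓ), sub_eq_zero]
    rw [Finset.card_filter]
    push_cast
    rw [Finset.mul_sum]
    simp
  exact_mod_cast this

theorem sum_norm_powExpSum_sq_le {p : ℕ} (hp : 0 < p) :
    ∑ a : ZMod ℓ, ‖powExpSum p a‖ ^ 2 ≤ p * (ℓ : ℝ) ^ 2 := by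
  rw [sum_norm_powExpSum_sq]
  calc (ℓ : ℝ) * ∑ y : ZMod ℓ, ((Finset.univ.filter fun x : ZMod ℓ => x ^ p = y ^ p).card : ℝ)
      ≤ ℓ * ∑ y : ZMod ℓ, (p : ℝ) := by
        gcongr with y
        exact card_pow_eq_le hp _
    _ = p * (ℓ : ℝ) ^ 2 := by
        simp [ZMod.card]
        ring

theorem powExpSum_mul_pow (p : ℕ) (a : ZMod ℓ) {h : ZMod ℓ} (hh : h ≠ 0) :
    powExpSum p (a * h ^ p) = powExpSum p a := by
  refine Fintype.sum_equiv (Equiv.mulLeft₀ h hh) _ _ fun x => ?_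
  simp [mul_pow, mul_assoc]

/-- The sum takes the same value at all `a * h ^ p` with `h ≠ 0`, and each value `b` is `a * h ^ p`
for at most `p` choices of `h`. The mean square bound therefore becomes a pointwise one, at the cost
of a factor `p`; no Gauss sums are needed. -/
theorem norm_powExpSum_sq_le {p : ℕ} (hp : 0 < p) {a : ZMod ℓ} (ha : a ≠ 0) :
    ((ℓ : ℝ) - 1) * ‖powExpSum p a‖ ^ 2 ≤ (p : ℝ) ^ 2 * (ℓ : ℝ) ^ 2 := by
  classical
  have hℓ : 1 ≤ ℓ := (Fact.out : ℓ.Prime).one_le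
  have h1 : ((ℓ : ℝ) - 1) * ‖powExpSum p a‖ ^ 2 =
      ∑ h ∈ Finset.univ.erase (0 : ZMod ℓ), ‖powExpSum p (a * h ^ p)‖ ^ 2 := by
    rw [Finset.sum_congr rfl fun h hh => by
      rw [powExpSum_mul_pow p a (Finset.ne_of_mem_erase hh)]]
    simp [Finset.card_erase_of_mem, ZMod.card, Nat.cast_sub hℓ]
  rw [h1]
  calc ∑ h ∈ Finset.univ.erase (0 : ZMod ℓ), ‖powExpSum p (a * h ^ p)‖ ^ 2
      ≤ ∑ h : ZMod ℓ, ‖powExpSum p (a * h ^ p)‖ ^ 2 :=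
        Finset.sum_le_sum_of_subset_of_nonneg (Finset.erase_subset _ _)
          fun _ _ _ => by positivity
    _ = ∑ b : ZMod ℓ, ∑ h ∈ Finset.univ.filter (fun h : ZMod ℓ => a * h ^ p = b),
          ‖powExpSum p (a * h ^ p)‖ ^ 2 := (Finset.sum_fiberwise _ _ _).symm
    _ ≤ ∑ b : ZMod ℓ, p * ‖powExpSum p b‖ ^ 2 := by
        refine Finset.sum_le_sum fun b _ => ?_
        rw [Finset.sum_congr rfl fun h hh => by rw [(Finset.mem_filter.1 hh).2],
          Finset.sum_const, nsmul_eq_mul]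
        gcongr
        refine le_trans (Finset.card_le_card ?_) (card_pow_eq_le hp (a⁻¹ * b))
        intro h hh
        simp only [Finset.mem_filter, Finset.mem_univ, true_and] at hh ⊢
        rw [← hh, inv_mul_cancel_left₀ ha]
    _ ≤ (p : ℝ) ^ 2 * (ℓ : ℝ) ^ 2 := by
        rw [← Finset.mul_sum, pow_two (p : ℝ), mul_assoc]
        gcongr
        exact sum_norm_powExpSum_sq_le hp

open Classical in
theorem sum_powExpSum_mul (p : ℕ) (u v w : ZMod ℓ) :
    ∑ t : ZMod ℓ, powExpSum p (t * u) * powExpSum p (t * v) * powExpSum p (t * w) =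
      ℓ * ((Finset.univ.filter fun x : ZMod ℓ × ZMod ℓ × ZMod ℓ =>
        u * x.1 ^ p + v * x.2.1 ^ p + w * x.2.2 ^ p = 0).card : ℂ) := by
  have key : ∀ t : ZMod ℓ, powExpSum p (t * u) * powExpSum p (t * v) * powExpSum p (t * w) =
      ∑ x : ZMod ℓ × ZMod ℓ × ZMod ℓ,
        ZMod.stdAddChar (t * (u * x.1 ^ p + v * x.2.1 ^ p + w * x.2.2 ^ p)) := by
    intro t
    simp only [powExpSum, Fintype.sum_prod_type]
    rw [mul_assoc, Finset.sum_mul]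
    refine Finset.sum_congr rfl fun x _ => ?_
    rw [Finset.sum_mul_sum, Finset.mul_sum]
    refine Finset.sum_congr rfl fun y _ => ?_
    rw [Finset.mul_sum]
    refine Finset.sum_congr rfl fun z _ => ?_
    rw [← AddChar.map_add_eq_mul, ← AddChar.map_add_eq_mul]
    congr 1
    ring
  simp_rw [key]
  rw [Finset.sum_comm]
  simp_rw [AddChar.sum_mulShift _ (ZMod.isPrimitive_stdAddChar ℓ)]
  rw [Finset.card_filter]
  push_cast
  rw [Finset.mul_sum]
  simp

/-- Circle method: in `sum_powExpSum_mul` the term `t = 0` equals `ℓ ^ 3`. If zero were the only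
solution, the right side would be at most `ℓ`, and the other `ℓ - 1` terms, each of size `O(ℓ ^ (3 /
2))`, could not cancel `ℓ ^ 3` for large `ℓ`. -/
theorem exists_fermat_solution_of_lt {p : ℕ} (hp : 0 < p) (hℓ : 8 * p ^ 6 < ℓ) {u v w : ZMod ℓ}
    (hu : u ≠ 0) (hv : v ≠ 0) (hw : w ≠ 0) :
    ∃ x y z : ZMod ℓ, (x ≠ 0 ∨ y ≠ 0 ∨ z ≠ 0) ∧ u * x ^ p + v * y ^ p + w * z ^ p = 0 := by
  classical
  by_contra! hno
  have hcard : (Finset.univ.filter fun x : ZMod ℓ × ZMod ℓ × ZMod ℓ =>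
        u * x.1 ^ p + v * x.2.1 ^ p + w * x.2.2 ^ p = 0).card ≤ 1 := by
    refine Finset.card_le_one_iff_subset_singleton.2 ⟨0, ?_⟩
    rintro ⟨x, y, z⟩ h
    simp only [Finset.mem_filter, Finset.mem_univ, true_and] at h
    have := hno x y z
    simp only [Finset.mem_singleton, Prod.mk_eq_zero]
    tauto
  have hℓ2 : (2 : ℝ) ≤ ℓ := by exact_mod_cast (Fact.out : ℓ.Prime).two_le
  -- The factor `2` absorbs `ℓ / (ℓ - 1)` in `norm_powExpSum_sq_le`.
  obtain ⟨B, hB0, hB⟩ : ∃ B : ℝ, 0 ≤ B ∧ B ^ 2 = 2 * (p : ℝ) ^ 2 * ℓ :=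
    ⟨Real.sqrt (2 * (p : ℝ) ^ 2 * ℓ), Real.sqrt_nonneg _, Real.sq_sqrt (by positivity)⟩
  have hS : ∀ a : ZMod ℓ, a ≠ 0 → ‖powExpSum p a‖ ≤ B := by
    intro a ha
    refine abs_le_of_sq_le_sq' ?_ hB0 |>.2
    have h := norm_powExpSum_sq_le hp ha
    rw [hB]
    have h1 : (ℓ : ℝ) * ‖powExpSum p a‖ ^ 2 ≤ ℓ * (2 * (p : ℝ) ^ 2 * ℓ) := by
      nlinarith [sq_nonneg ‖powExpSum p a‖]
    exact le_of_mul_le_mul_left h1 (by linarith)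
  have hsum := sum_powExpSum_mul p u v w
  rw [← Finset.add_sum_erase _ _ (Finset.mem_univ (0 : ZMod ℓ))] at hsum
  have h0 : powExpSum p (0 : ZMod ℓ) = ℓ := by simp [powExpSum, ZMod.card]
  simp only [zero_mul, h0] at hsum
  set n := (Finset.univ.filter fun x : ZMod ℓ × ZMod ℓ × ZMod ℓ =>
        u * x.1 ^ p + v * x.2.1 ^ p + w * x.2.2 ^ p = 0).card
  have hmain : (ℓ : ℝ) ^ 3 ≤ ℓ + (ℓ - 1) * B ^ 3 := by
    have h1 : ((ℓ : ℂ)) ^ 3 = ℓ * (n : ℂ) - ∑ t ∈ Finset.univ.erase (0 : ZMod ℓ),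
        powExpSum p (t * u) * powExpSum p (t * v) * powExpSum p (t * w) := by
      rw [← hsum]; ring
    have h2 := congrArg norm h1
    rw [norm_pow, Complex.norm_natCast] at h2
    rw [h2]
    refine (norm_sub_le _ _).trans (add_le_add ?_ ?_)
    · rw [norm_mul, Complex.norm_natCast, Complex.norm_natCast]
      have : (n : ℝ) ≤ 1 := by exact_mod_cast hcard
      nlinarith
    · refine (norm_sum_le_of_le (f := fun t => powExpSum p (t * u) * powExpSum p (t * v) * powExpSum p (t * w)) (n := fun _ => B ^ 3) _ fun t ht => ?_).trans ?_
      · have ht0 := Finset.ne_of_mem_erase ht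
        rw [norm_mul, norm_mul, pow_succ, pow_two]
        gcongr
        · exact hS _ (mul_ne_zero ht0 hu)
        · exact hS _ (mul_ne_zero ht0 hv)
        · exact hS _ (mul_ne_zero ht0 hw)
      · simp [Finset.card_erase_of_mem, ZMod.card, Nat.cast_sub (Fact.out : ℓ.Prime).one_le]
  -- Cancel `ℓ - 1` from `ℓ ^ 3 - ℓ ≤ (ℓ - 1) * B ^ 3`; squaring then gives `ℓ ^ 4 ≤ 8 p ^ 6 ℓ ^ 3`.
  have h3 : (ℓ : ℝ) * (ℓ + 1) ≤ B ^ 3 := by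
    refine le_of_mul_le_mul_left (a := (ℓ : ℝ) - 1) ?_ (by linarith)
    nlinarith
  have h4 : (ℓ : ℝ) ^ 2 ≤ B ^ 3 := by nlinarith
  have h5 : ((ℓ : ℝ) ^ 2) ^ 2 ≤ (B ^ 3) ^ 2 := pow_le_pow_left₀ (by positivity) h4 2
  have h6 : (B ^ 3) ^ 2 = 8 * (p : ℝ) ^ 6 * ℓ ^ 3 := by
    rw [← pow_mul, mul_comm, pow_mul, hB]; ring
  have h7 : (8 * (p : ℝ) ^ 6) < ℓ := by exact_mod_cast hℓ
  have h8 : 8 * (p : ℝ) ^ 6 * ℓ ^ 3 < ℓ * ℓ ^ 3 := by gcongr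
  nlinarith

end FermatCount

theorem exceptionalPrimes_finite {p : ℕ} (hp : 0 < p) : (exceptionalPrimes p).Finite := by
  refine (Set.finite_Iic (8 * p ^ 6)).subset ?_
  rintro ℓ ⟨hℓ, -, u, v, w, h⟩
  by_contra hlt
  refine (fermatPoints_ne_empty_iff p (u : ZMod ℓ) v w (ZMod ℓ)).2 ?_ h
  exact exists_fermat_solution_of_lt hp (not_le.1 hlt) u.ne_zero v.ne_zero w.ne_zero

/-- Finiteness is essential here: over an infinite set of primes the `finprod` would take its
default value `1`. -/
theorem dvd_exceptionalModulus {p ℓ : ℕ} (hp : 0 < p) (hℓ : ℓ ∈ exceptionalPrimes p) :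
    ℓ ∣ exceptionalModulus p := by
  rw [exceptionalModulus, finprod_mem_eq_finite_toFinset_prod _ (exceptionalPrimes_finite hp)]
  exact (Finset.dvd_prod_of_mem _ (by simpa using hℓ)).mul_left p

/-! ### Solubility of diagonal ternary equations -/

/-- The equation `a x ^ n + b y ^ n + c z ^ n = 0` has a nonzero solution in `K`. -/
def FermatSoluble {K : Type*} [Field K] (n : ℕ) (a b c : K) : Prop :=
  ∃ x y z : K, (x ≠ 0 ∨ y ≠ 0 ∨ z ≠ 0) ∧ a * x ^ n + b * y ^ n + c * z ^ n = 0

theorem FermatSoluble.swap {K : Type*} [Field K] {n : ℕ} {a b c : K} (h : FermatSoluble n a b c) :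
    FermatSoluble n b a c := by
  obtain ⟨x, y, z, h, e⟩ := h
  exact ⟨y, x, z, by tauto, by rw [← e]; ring⟩

theorem FermatSoluble.rotate {K : Type*} [Field K] {n : ℕ} {a b c : K}
    (h : FermatSoluble n a b c) : FermatSoluble n b c a := by
  obtain ⟨x, y, z, h, e⟩ := h
  exact ⟨y, z, x, by tauto, by rw [← e]; ring⟩

theorem FermatSoluble.mul_pow {K : Type*} [Field K] {n : ℕ} {a b c u : K} (hu : u ≠ 0)
    (h : FermatSoluble n a b c) : FermatSoluble n a (b * u ^ n) c := by
  obtain ⟨x, y, z, h, e⟩ := h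
  refine ⟨x, y / u, z, h.imp_right (Or.imp_left fun hy => div_ne_zero hy hu), ?_⟩
  rw [← e, div_pow]
  field_simp

theorem not_hasLocalObstruction_iff (p a b c ℓ : ℕ) [Fact ℓ.Prime] :
    ¬ HasLocalObstruction p a b c ℓ ↔ FermatSoluble p (a : ℚ_[ℓ]) b c := by
  rw [HasLocalObstruction, ← ne_eq, fermatPoints_ne_empty_iff]
  simp [FermatSoluble]

/-! ### Lifting to the `ℓ`-adic numbers -/

section Hensel

variable {ℓ : ℕ} [Fact ℓ.Prime]

/-- Hensel's lemma for `α X ^ n + β`, in the form that allows a non-unit derivative, as is needed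
for `n = ℓ`. -/
theorem PadicInt.exists_mul_pow_add_eq_zero (n : ℕ) (α β ξ : ℤ_[ℓ])
    (h : ‖α * ξ ^ n + β‖ < ‖α * (n * ξ ^ (n - 1))‖ ^ 2) :
    ∃ x : ℤ_[ℓ], α * x ^ n + β = 0 ∧ ‖x - ξ‖ < ‖α * (n * ξ ^ (n - 1))‖ := by
  open Polynomial in
  obtain ⟨x, h1, h2, -⟩ := hensels_lemma (p := ℓ)
    (F := C α * (X : ℤ_[ℓ][X]) ^ n + C β) (a := ξ) (by simpa [Polynomial.derivative_X_pow] using h)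
  exact ⟨x, by simpa using h1, by simpa [Polynomial.derivative_X_pow] using h2⟩

theorem PadicInt.isUnit_of_norm_sub_lt {x ξ : ℤ_[ℓ]} (hξ : IsUnit ξ) (h : ‖x - ξ‖ < 1) :
    IsUnit x := by
  rw [PadicInt.isUnit_iff] at hξ ⊢
  have h1 : ‖x - ξ‖ ≠ ‖ξ‖ := by rw [hξ]; exact h.ne
  have h2 := PadicInt.norm_add_eq_max_of_ne h1
  rw [sub_add_cancel, hξ, max_eq_right h.le] at h2
  exact h2

theorem PadicInt.isUnit_iff_toZMod_ne_zero (x : ℤ_[ℓ]) : IsUnit x ↔ PadicInt.toZMod x ≠ 0 := by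
  rw [ne_eq, ← RingHom.mem_ker, PadicInt.ker_toZMod, IsLocalRing.mem_maximalIdeal, mem_nonunits_iff,
    not_not]

theorem PadicInt.norm_lt_one_iff_toZMod_eq_zero (x : ℤ_[ℓ]) : ‖x‖ < 1 ↔ PadicInt.toZMod x = 0 := by
  rw [← PadicInt.mem_nonunits, mem_nonunits_iff, PadicInt.isUnit_iff_toZMod_ne_zero, not_not]

/-- A solution modulo `ℓ` that is smooth in the first coordinate lifts to `ℚ_ℓ`. -/
theorem FermatSoluble.of_zmod {n a b c : ℕ} (hn : ¬ ℓ ∣ n) {x y z : ZMod ℓ}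
    (ha : (a : ZMod ℓ) ≠ 0) (hx : x ≠ 0)
    (h : (a : ZMod ℓ) * x ^ n + b * y ^ n + c * z ^ n = 0) :
    FermatSoluble n (a : ℚ_[ℓ]) b c := by
  obtain ⟨x, rfl⟩ := ZMod.ringHom_surjective (PadicInt.toZMod (p := ℓ)) x
  obtain ⟨y, rfl⟩ := ZMod.ringHom_surjective (PadicInt.toZMod (p := ℓ)) y
  obtain ⟨z, rfl⟩ := ZMod.ringHom_surjective (PadicInt.toZMod (p := ℓ)) z
  have hxu : IsUnit x := (PadicInt.isUnit_iff_toZMod_ne_zero x).2 hx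
  have hd : ‖(a : ℤ_[ℓ]) * (n * x ^ (n - 1))‖ = 1 := by
    rw [← PadicInt.isUnit_iff, PadicInt.isUnit_iff_toZMod_ne_zero]
    simp only [map_mul, map_natCast, map_pow]
    refine mul_ne_zero ha (mul_ne_zero ?_ (pow_ne_zero _ hx))
    rwa [ne_eq, ZMod.natCast_eq_zero_iff]
  -- Fix the lifts of `y` and `z` and solve for `x` alone.
  obtain ⟨x', h1, h2⟩ := PadicInt.exists_mul_pow_add_eq_zero n (a : ℤ_[ℓ])
    (b * y ^ n + c * z ^ n) x (by
      rw [hd, one_pow, PadicInt.norm_lt_one_iff_toZMod_eq_zero, ← h]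
      simp [add_assoc])
  rw [hd] at h2
  have hx' := (PadicInt.isUnit_of_norm_sub_lt hxu h2).ne_zero
  refine ⟨x', y, z, Or.inl (by simpa using hx'), ?_⟩
  have := congrArg (fun t : ℤ_[ℓ] => (t : ℚ_[ℓ])) h1
  simpa [add_assoc] using this

theorem FermatSoluble.of_zmod_of_ne_zero {n a b c : ℕ} (hn : ¬ ℓ ∣ n) (ha : (a : ZMod ℓ) ≠ 0)
    (hb : (b : ZMod ℓ) ≠ 0) (hc : (c : ZMod ℓ) ≠ 0)
    (h : FermatSoluble n (a : ZMod ℓ) b c) : FermatSoluble n (a : ℚ_[ℓ]) b c := by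
  obtain ⟨x, y, z, h | h | h, e⟩ := h
  · exact .of_zmod hn ha h e
  · exact (FermatSoluble.of_zmod hn hb h (y := x) (z := z) (by rw [← e]; ring)).swap
  · exact (FermatSoluble.of_zmod hn hc h (y := x) (z := y) (by rw [← e]; ring)).rotate

/-- For odd `p`, units of `ℤ_p` that are congruent modulo `p ^ 2` differ by a `p`-th power. -/
theorem PadicInt.exists_mul_pow_eq_of_dvd_sub (hodd : Odd ℓ) {q q' : ℤ_[ℓ]} (hq : IsUnit q)
    (h : (ℓ : ℤ_[ℓ]) ^ 2 ∣ q' - q) : ∃ u : ℤ_[ℓ], IsUnit u ∧ q * u ^ ℓ = q' := by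
  obtain ⟨m, hm⟩ := h
  -- Since `q` is a unit, `q' = q (1 + ℓ ^ 2 k)`. The approximate `ℓ`-th root of `1 + ℓ ^ 2 k` is `1
  -- + ℓ k`.
  obtain ⟨k, rfl⟩ := hq.dvd (a := m)
  have hℓ := (Fact.out : ℓ.Prime)
  have hξ : IsUnit (1 + ℓ * k : ℤ_[ℓ]) := by
    rw [PadicInt.isUnit_iff_toZMod_ne_zero]
    simp
  -- The geometric sum is `ℓ` mod `ℓ ^ 2`, so `(1 + ℓ k) ^ ℓ ≡ 1 + ℓ ^ 2 k` mod `ℓ ^ 3`. Oddness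
  -- matters: for `ℓ = 2` the term `4 k ^ 2` survives. The error `ℓ ^ 3` just beats the square of
  -- the derivative, whose norm is `ℓ⁻¹`.
  obtain ⟨w, hw⟩ := odd_sq_dvd_geom_sum₂_sub (a := (1 : ℤ_[ℓ])) (b := k) hodd
  have hgeom := (Commute.all (1 + ℓ * k : ℤ_[ℓ]) 1).geom_sum₂_mul ℓ
  have hval : q * (1 + ℓ * k) ^ ℓ + -q' = (ℓ : ℤ_[ℓ]) ^ 3 * (q * w * k) := by
    have h1 : q' = q + (ℓ : ℤ_[ℓ]) ^ 2 * (q * k) := by rw [← hm]; ring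
    rw [sub_eq_iff_eq_add] at hw
    rw [hw, one_pow, one_pow, mul_one] at hgeom
    rw [h1]
    linear_combination (-q) * hgeom
  have hlt : ((ℓ : ℝ)⁻¹) < 1 := inv_lt_one_of_one_lt₀ (by exact_mod_cast hℓ.one_lt)
  have hpos : 0 < ((ℓ : ℝ)⁻¹) := inv_pos.2 (by exact_mod_cast hℓ.pos)
  have hd : ‖q * (ℓ * (1 + ℓ * k) ^ (ℓ - 1))‖ = (ℓ : ℝ)⁻¹ := by
    rw [norm_mul, norm_mul, norm_pow, PadicInt.isUnit_iff.1 hq, PadicInt.isUnit_iff.1 hξ,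
      PadicInt.norm_p]
    simp
  obtain ⟨u, hu, hu'⟩ := PadicInt.exists_mul_pow_add_eq_zero ℓ q (-q') (1 + ℓ * k) (by
    rw [hd, hval, norm_mul, norm_pow, PadicInt.norm_p]
    calc _ ≤ (ℓ : ℝ)⁻¹ ^ 3 * 1 := by
          gcongr
          exact PadicInt.norm_le_one _
      _ < _ := by
          rw [mul_one]
          exact pow_lt_pow_right_of_lt_one₀ hpos hlt (by norm_num))
  rw [hd] at hu'
  exact ⟨u, PadicInt.isUnit_of_norm_sub_lt hξ (hu'.trans hlt), by linear_combination hu⟩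

/-- Solubility over `ℚ_p` depends only on the class of the unit coefficient `b` modulo `p ^ 2`. -/
theorem FermatSoluble.congr_mod_sq (hodd : Odd ℓ) {a c : ℚ_[ℓ]} {q q' : ℕ}
    (hq : ¬ ℓ ∣ q) (h : (q : ZMod (ℓ ^ 2)) = q') (hs : FermatSoluble ℓ a (q : ℚ_[ℓ]) c) :
    FermatSoluble ℓ a (q' : ℚ_[ℓ]) c := by
  have hu : IsUnit (q : ℤ_[ℓ]) := by
    rw [PadicInt.isUnit_iff_toZMod_ne_zero, map_natCast]
    rwa [ne_eq, ZMod.natCast_eq_zero_iff]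
  have hd : (ℓ : ℤ_[ℓ]) ^ 2 ∣ (q' : ℤ_[ℓ]) - q := by
    have h1 : ((ℓ ^ 2 : ℕ) : ℤ) ∣ (q' : ℤ) - q := by
      rw [← ZMod.intCast_zmod_eq_zero_iff_dvd]
      simp [h]
    have := map_dvd (Int.castRingHom ℤ_[ℓ]) h1
    simpa using this
  obtain ⟨u, hu1, hu2⟩ := PadicInt.exists_mul_pow_eq_of_dvd_sub hodd hu hd
  have h2 := congrArg (fun t : ℤ_[ℓ] => (t : ℚ_[ℓ])) hu2
  have h3 : (u : ℚ_[ℓ]) ≠ 0 := by simpa using hu1.ne_zero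
  have h4 : (q' : ℚ_[ℓ]) = q * (u : ℚ_[ℓ]) ^ ℓ := by simpa using h2.symm
  rw [h4]
  exact hs.mul_pow h3

end Hensel

/-! ### Local solubility away from `p` -/

/-- If `p` is prime to `ℓ - 1`, every element of `ZMod ℓ` is a `p`-th power. -/
theorem ZMod.exists_pow_eq_of_not_modEq_one {p ℓ : ℕ} [Fact ℓ.Prime] (hp : p.Prime)
    (h : ¬ ℓ ≡ 1 [MOD p]) (c : ZMod ℓ) : ∃ x : ZMod ℓ, x ^ p = c := by
  rcases eq_or_ne c 0 with rfl | hc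
  · exact ⟨0, zero_pow hp.ne_zero⟩
  have hcop : (Nat.card (ZMod ℓ)ˣ).Coprime p := by
    rw [Nat.card_eq_fintype_card, ZMod.card_units, Nat.coprime_comm, hp.coprime_iff_not_dvd]
    intro hd
    exact h ((Nat.modEq_iff_dvd' (Fact.out : ℓ.Prime).one_le).2 hd).symm
  refine ⟨((powCoprime hcop).symm (Units.mk0 c hc) : (ZMod ℓ)ˣ), ?_⟩
  have := (powCoprime hcop).apply_symm_apply (Units.mk0 c hc)
  rw [powCoprime_apply] at this
  rw [← Units.val_pow_eq_pow_val, this, Units.val_mk0]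

/-- Under the hypotheses on `r`, the only possible local obstruction is at `p`. -/
theorem fermatSoluble_of_ne {p r q ℓ : ℕ} [Fact ℓ.Prime] (hp : p.Prime) (hp5 : 5 ≤ p)
    (hr : r.Prime) (hrN : (r : ℤ) ≡ -1 [ZMOD (exceptionalModulus p : ℤ)]) (hq : q.Prime)
    (hq1 : ¬ q ≡ 1 [MOD p]) (hqr : q ≠ r) (hℓ : ℓ ≠ p) :
    FermatSoluble p (1 : ℚ_[ℓ]) q r := by
  have hℓp := (Fact.out : ℓ.Prime)
  have hn : ¬ ℓ ∣ p := fun h => hℓ ((Nat.prime_dvd_prime_iff_eq hℓp hp).1 h)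
  have hne : ∀ s : ℕ, s.Prime → ℓ ≠ s → (s : ZMod ℓ) ≠ 0 := fun s hs hls => by
    rw [ne_eq, ZMod.natCast_eq_zero_iff, Nat.prime_dvd_prime_iff_eq hℓp hs]
    exact hls
  have hr1 : ¬ r ≡ 1 [MOD p] := by
    intro h1
    have h2 : (r : ℤ) ≡ -1 [ZMOD (p : ℤ)] :=
      hrN.of_dvd (by rw [exceptionalModulus]; push_cast; exact dvd_mul_right _ _)
    have h3 : (r : ℤ) ≡ 1 [ZMOD (p : ℤ)] := by exact_mod_cast (Int.natCast_modEq_iff.2 h1)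
    have h4 := (h2.symm.trans h3).dvd
    norm_num at h4
    have := Int.le_of_dvd (by norm_num) h4
    omega
  have hone : ((1 : ℕ) : ZMod ℓ) ≠ 0 := by simp
  have hneg : ∀ s : ℕ, s.Prime → ℓ ≠ s → (¬ ℓ ≡ 1 [MOD p]) → ∃ x : ZMod ℓ, x ≠ 0 ∧ x ^ p = -s := by
    intro s hs hls h1
    obtain ⟨x, hx⟩ := ZMod.exists_pow_eq_of_not_modEq_one hp h1 (-(s : ZMod ℓ))
    refine ⟨x, ?_, hx⟩
    rintro rfl
    rw [zero_pow hp.ne_zero] at hx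
    exact hne s hs hls (neg_eq_zero.1 hx.symm)
  suffices h : FermatSoluble p ((1 : ℕ) : ℚ_[ℓ]) q r by simpa using h
  by_cases hlq : ℓ = q
  -- At `ℓ = q` the middle term vanishes mod `ℓ`; the point is `(x : 0 : 1)` with `x ^ p = -r`. This
  -- needs `q ≠ r`.
  · obtain ⟨x, hx0, hx⟩ := hneg r hr (by rw [hlq]; exact hqr) (by rwa [hlq])
    exact .of_zmod hn hone hx0 (y := 0) (z := 1) (by simp [hx, hp.ne_zero])
  by_cases hlr : ℓ = r
  · obtain ⟨x, hx0, hx⟩ := hneg q hq hlq (by rwa [hlr])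
    exact .of_zmod hn hone hx0 (y := 1) (z := 0) (by simp [hx, hp.ne_zero])
  by_cases hex : ℓ ∈ exceptionalPrimes p
  -- At an exceptional `ℓ`, the congruence on `r` puts `(1 : 0 : 1)` on the reduction.
  · have h1 : (r : ℤ) ≡ -1 [ZMOD (ℓ : ℤ)] :=
      hrN.of_dvd (by exact_mod_cast dvd_exceptionalModulus hp.pos hex)
    have h2 : (r : ZMod ℓ) = -1 := by
      have := (ZMod.intCast_eq_intCast_iff _ _ _).2 h1
      simpa using this
    exact .of_zmod hn hone one_ne_zero (y := 0) (z := 1) (by simp [h2, hp.ne_zero])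
  · refine .of_zmod_of_ne_zero hn hone (hne q hq hlq) (hne r hr hlr) ?_
    by_contra hno
    refine hex ⟨‹_›, hℓ, Units.mk0 _ hone, Units.mk0 _ (hne q hq hlq), Units.mk0 _ (hne r hr hlr),
      not_not.1 fun h => hno ?_⟩
    exact (fermatPoints_ne_empty_iff _ _ _ _ _).1 h

/-! ### Logarithmic singularity of the Dirichlet series of a residue class -/

section ResidueClass

open ArithmeticFunction ArithmeticFunction.vonMangoldt Complex LSeries

variable {M : ℕ} {a : ZMod M}

/-- The coefficients `Λ(n) / log n`, restricted to the residue class `a`. -/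
noncomputable def residueClassDivLog (a : ZMod M) (n : ℕ) : ℝ :=
  residueClass a n / Real.log n

theorem residueClass_one_eq_zero (a : ZMod M) : residueClass a 1 = 0 :=
  le_antisymm ((residueClass_le a 1).trans (by simp)) (residueClass_nonneg a 1)

/-- Dividing by `log n` integrates the Dirichlet series: the derivative of the new one is minus the
series of `residueClass`. At `n = 0, 1`, where the logarithm is `0`, both sides vanish. -/
theorem logMul_residueClassDivLog (a : ZMod M) :
    logMul (fun n => (residueClassDivLog a n : ℂ)) = fun n => (residueClass a n : ℂ) := by
  funext n
  rw [logMul, residueClassDivLog]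
  rcases n with _ | _ | n
  · simp
  · simp only [zero_add, residueClass_one_eq_zero]; simp
  · have h : Real.log ((n + 1 + 1 : ℕ) : ℝ) ≠ 0 :=
      (Real.log_pos (by push_cast; linarith [(n.cast_nonneg : (0 : ℝ) ≤ n)])).ne'
    rw [← natCast_log, ← ofReal_mul, mul_div_cancel₀ _ h]

theorem abscissaOfAbsConv_residueClassDivLog_le_one (a : ZMod M) :
    abscissaOfAbsConv (fun n => (residueClassDivLog a n : ℂ)) ≤ 1 := by
  rw [← LSeries.abscissaOfAbsConv_logMul, logMul_residueClassDivLog]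
  exact abscissaOfAbsConv_residueClass_le_one a

/-- The derivative of the left side is `-LFunctionResidueClassAux a`, the series of `residueClass`
with its pole removed. It is continuous up to `s = 1` (the arithmetic input of Dirichlet's theorem),
hence bounded on `[1, 2]`, and the mean value inequality from `2` applies. -/
theorem exists_norm_LSeries_residueClassDivLog_add_log_le [NeZero M] (ha : IsUnit a) :
    ∃ C : ℝ, ∀ x ∈ Set.Ioc (1 : ℝ) 2,
      ‖LSeries (fun n => (residueClassDivLog a n : ℂ)) x +
        (M.totient : ℂ)⁻¹ * (Real.log (x - 1) : ℂ)‖ ≤ C := by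
  set G : ℝ → ℂ := fun x => LSeries (fun n => (residueClassDivLog a n : ℂ)) x +
        (M.totient : ℂ)⁻¹ * (Real.log (x - 1) : ℂ) with hG
  have hder : ∀ x ∈ Set.Ioc (1 : ℝ) 2,
      HasDerivAt G (-LFunctionResidueClassAux a x) x := by
    intro x hx
    have hx1 : (1 : ℝ) < (x : ℂ).re := by simpa using hx.1
    have h1 : HasDerivAt (fun x : ℝ => LSeries (fun n => (residueClassDivLog a n : ℂ)) x)
        (-LSeries (fun n => (residueClass a n : ℂ)) x) x := by
      rw [← logMul_residueClassDivLog]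
      exact (LSeries_hasDerivAt
        ((abscissaOfAbsConv_residueClassDivLog_le_one a).trans_lt (by exact_mod_cast hx1))).comp_ofReal
    have h2 : HasDerivAt (fun x : ℝ => (Real.log (x - 1) : ℂ)) (((1 / (x - 1) : ℝ)) : ℂ) x :=
      (((hasDerivAt_id x).sub_const 1).log (sub_pos.2 hx.1).ne').ofReal_comp
    have h3 := h1.add (h2.const_mul (M.totient : ℂ)⁻¹)
    rw [eqOn_LFunctionResidueClassAux ha hx1]
    convert! h3 using 1
    push_cast
    ring
  have hcont : ContinuousOn (fun x : ℝ => LFunctionResidueClassAux a (x : ℂ)) (Set.Icc 1 2) :=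
    (continuousOn_LFunctionResidueClassAux a).comp continuous_ofReal.continuousOn
      fun x hx => by simpa using hx.1
  obtain ⟨C, hC⟩ := isCompact_Icc.exists_bound_of_continuousOn hcont
  refine ⟨‖G 2‖ + C, fun x hx => ?_⟩
  have hmv := (convex_Ioc (1 : ℝ) 2).norm_image_sub_le_of_norm_hasDerivWithin_le
    (f := G) (C := C) (fun y hy => (hder y hy).hasDerivWithinAt)
    (fun y hy => by rw [norm_neg]; exact hC y (Set.Ioc_subset_Icc_self hy))
    (Set.right_mem_Ioc.2 one_lt_two) hx
  have hC0 : 0 ≤ C := (norm_nonneg _).trans (hC 1 (by simp))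
  have h4 : ‖x - 2‖ ≤ 1 := by
    rw [Real.norm_eq_abs, abs_le]
    constructor <;> linarith [hx.1, hx.2]
  calc ‖G x‖ = ‖G 2 + (G x - G 2)‖ := by rw [add_sub_cancel]
    _ ≤ ‖G 2‖ + ‖G x - G 2‖ := norm_add_le _ _
    _ ≤ ‖G 2‖ + C := by
        gcongr
        exact hmv.trans (mul_le_of_le_one_right hC0 h4)

theorem residueClassDivLog_nonneg (a : ZMod M) (n : ℕ) : 0 ≤ residueClassDivLog a n :=
  div_nonneg (residueClass_nonneg a n) (Real.log_natCast_nonneg n)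

end ResidueClass

/-! ### Prime sums and Dirichlet density of unions of residue classes -/

/-- The partial sum `∑ q ^ (-s)` over the primes `q` in `T`. -/
noncomputable def primeZetaSum (T : Set ℕ) (s : ℝ) : ℝ :=
  ∑' n : ℕ, {q | q.Prime ∧ q ∈ T}.indicator (fun n : ℕ => (n : ℝ) ^ (-s)) n

theorem summable_primeZetaSum (T : Set ℕ) {s : ℝ} (hs : 1 < s) :
    Summable ({q | q.Prime ∧ q ∈ T}.indicator (fun n : ℕ => (n : ℝ) ^ (-s))) :=
  (Real.summable_nat_rpow.2 (by linarith)).indicator _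

section

open ArithmeticFunction ArithmeticFunction.vonMangoldt

variable {M : ℕ} [NeZero M] {a : ZMod M}

/-- `Λ(n) / log n` is `1` at primes, so the prime sum differs from the series of
`residueClassDivLog` only by proper prime powers, whose contribution is bounded uniformly in `s >
1`. -/
theorem exists_abs_primeZetaSum_add_log_le (ha : IsUnit a) :
    ∃ C : ℝ, ∀ s ∈ Set.Ioc (1 : ℝ) 2,
      |primeZetaSum {q | (q : ZMod M) = a} s + (M.totient : ℝ)⁻¹ * Real.log (s - 1)| ≤ C := by
  obtain ⟨C, hC⟩ := exists_norm_LSeries_residueClassDivLog_add_log_le ha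
  have hsum := summable_residueClass_non_primes_div a
  set D := ∑' n : ℕ, (if n.Prime then 0 else residueClass a n) / (n : ℝ) with hD
  refine ⟨C + 2 * D, fun s hs => ?_⟩
  have hLs : Summable fun n : ℕ => residueClassDivLog a n * (n : ℝ) ^ (-s) := by
    have h1 := LSeries.summable_real_of_abscissaOfAbsConv_lt
      ((abscissaOfAbsConv_residueClassDivLog_le_one a).trans_lt
        (show (1 : EReal) < (s : ℝ) by exact_mod_cast hs.1))
    refine h1.congr fun n => ?_
    rw [Real.rpow_neg n.cast_nonneg, div_eq_mul_inv]
  have hL : LSeries (fun n => (residueClassDivLog a n : ℂ)) s =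
      ((∑' n : ℕ, residueClassDivLog a n * (n : ℝ) ^ (-s) : ℝ) : ℂ) := by
    rw [LSeries, Complex.ofReal_tsum]
    refine tsum_congr fun n => ?_
    rcases eq_or_ne n 0 with rfl | hn
    · simp [residueClassDivLog]
    · rw [LSeries.term_of_ne_zero hn, Complex.ofReal_mul, Complex.ofReal_cpow n.cast_nonneg,
        Complex.ofReal_neg, Complex.cpow_neg, div_eq_mul_inv, Complex.ofReal_natCast]
  have hCs := hC s hs
  rw [hL, ← Complex.ofReal_natCast, ← Complex.ofReal_inv, ← Complex.ofReal_mul,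
    ← Complex.ofReal_add, Complex.norm_real, Real.norm_eq_abs] at hCs
  -- This gives `1 / log n ≤ 2` for `n ≥ 2`, the source of the factor in `2 * D`.
  have hlog2 : (1 : ℝ) / 2 ≤ Real.log 2 := by linarith [Real.log_two_gt_d9]
  have hterm : ∀ n : ℕ, |residueClassDivLog a n * (n : ℝ) ^ (-s) -
      {q | q.Prime ∧ q ∈ {q : ℕ | (q : ZMod M) = a}}.indicator (fun n : ℕ => (n : ℝ) ^ (-s)) n| ≤
      2 * ((if n.Prime then 0 else residueClass a n) / (n : ℝ)) := by
    intro n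
    by_cases hn : n.Prime
    · have hlog : Real.log n ≠ 0 := (Real.log_pos (by exact_mod_cast hn.one_lt)).ne'
      by_cases hna : (n : ZMod M) = a
      · simp [residueClassDivLog, residueClass, hn, hna, vonMangoldt_apply_prime hn, hlog]
      · simp [residueClassDivLog, residueClass, hn, hna]
    · rw [Set.indicator_of_notMem (by simp [hn]), sub_zero, if_neg hn,
        abs_of_nonneg (mul_nonneg (residueClassDivLog_nonneg a n) (by positivity))]
      rcases n with _ | _ | n
      · simp [residueClassDivLog]
      · simp only [zero_add, residueClassDivLog, residueClass_one_eq_zero]; simp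
      · set m := n + 1 + 1
        have hm : (2 : ℝ) ≤ m := by exact_mod_cast (show 2 ≤ m by omega)
        have h1 : (1 : ℝ) / 2 ≤ Real.log m := hlog2.trans (Real.log_le_log (by norm_num) hm)
        have h2 : (m : ℝ) ^ (-s) ≤ (m : ℝ)⁻¹ := by
          rw [← Real.rpow_neg_one]
          exact Real.rpow_le_rpow_of_exponent_le (by linarith) (by linarith [hs.1])
        have h3 : residueClassDivLog a m ≤ 2 * residueClass a m := by
          rw [residueClassDivLog, div_le_iff₀ (by linarith)]
          nlinarith [residueClass_nonneg a m]
        calc residueClassDivLog a m * (m : ℝ) ^ (-s)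
            ≤ (2 * residueClass a m) * (m : ℝ)⁻¹ := by
              gcongr
              exact mul_nonneg zero_le_two (residueClass_nonneg a m)
          _ = _ := by ring
  have hdiff : |(∑' n : ℕ, residueClassDivLog a n * (n : ℝ) ^ (-s)) -
      primeZetaSum {q | (q : ZMod M) = a} s| ≤ 2 * D := by
    rw [primeZetaSum, ← hLs.tsum_sub (summable_primeZetaSum _ hs.1), hD, ← tsum_mul_left,
      ← Real.norm_eq_abs]
    exact tsum_of_norm_bounded (hsum.mul_left 2).hasSum hterm
  rw [abs_le] at hCs hdiff ⊢
  constructor <;> linarith [hCs.1, hCs.2, hdiff.1, hdiff.2]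

end

/-- Each prime of `E` changes the sum by at most `1`, a bounded amount that is invisible to the
density. -/
theorem abs_primeZetaSum_sub_le {T T' : Set ℕ} (E : Finset ℕ)
    (h : ∀ q : ℕ, q.Prime → q ∉ E → (q ∈ T ↔ q ∈ T')) {s : ℝ} (hs : 1 < s) :
    |primeZetaSum T s - primeZetaSum T' s| ≤ E.card := by
  classical
  rw [primeZetaSum, primeZetaSum,
    ← (summable_primeZetaSum T hs).tsum_sub (summable_primeZetaSum T' hs), ← Real.norm_eq_abs]
  have hsum : HasSum ((E : Set ℕ).indicator fun _ => (1 : ℝ)) E.card := by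
    have : HasSum ((E : Set ℕ).indicator fun _ => (1 : ℝ)) _ :=
      hasSum_sum_of_ne_finset_zero (s := E) fun b hb =>
        Set.indicator_of_notMem (by simpa using hb) _
    rwa [Finset.sum_indicator_subset _ (Finset.Subset.refl E), Finset.sum_const, nsmul_one] at this
  refine tsum_of_norm_bounded hsum fun q => ?_
  by_cases hq : q.Prime
  · have hle : (q : ℝ) ^ (-s) ≤ 1 :=
      Real.rpow_le_one_of_one_le_of_nonpos (by exact_mod_cast hq.one_le) (by linarith)
    have h0 : (0 : ℝ) ≤ (q : ℝ) ^ (-s) := by positivity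
    by_cases hE : q ∈ E
    · rw [Set.indicator_of_mem (s := (E : Set ℕ)) (by simpa using hE), Real.norm_eq_abs, abs_le]
      simp only [Set.indicator_apply]
      split_ifs <;> constructor <;> linarith
    · have := h q hq hE
      simp [Set.indicator_apply, hE, this]
  · simp [Set.indicator_apply, hq, ite_nonneg]

theorem primeZetaSum_mem_finset {M : ℕ} (A : Finset (ZMod M)) {s : ℝ} (hs : 1 < s) :
    primeZetaSum {q | (q : ZMod M) ∈ A} s = ∑ a ∈ A, primeZetaSum {q | (q : ZMod M) = a} s := by
  simp only [primeZetaSum]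
  rw [← Summable.tsum_finsetSum fun a _ => summable_primeZetaSum _ hs]
  refine tsum_congr fun n => ?_
  by_cases hn : n.Prime <;> simp [Set.indicator_apply, hn]

theorem exists_abs_primeZetaSum_add_card_mul_log_le {M : ℕ} [NeZero M] {T : Set ℕ}
    (A : Finset (ZMod M)) (hA : ∀ a ∈ A, IsUnit a) (E : Finset ℕ)
    (h : ∀ q : ℕ, q.Prime → q ∉ E → (q ∈ T ↔ (q : ZMod M) ∈ A)) :
    ∃ C : ℝ, ∀ s ∈ Set.Ioc (1 : ℝ) 2,
      |primeZetaSum T s + A.card / (M.totient : ℝ) * Real.log (s - 1)| ≤ C := by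
  have hex : ∀ a : ZMod M, ∃ C : ℝ, a ∈ A → ∀ s ∈ Set.Ioc (1 : ℝ) 2,
      |primeZetaSum {q | (q : ZMod M) = a} s + (M.totient : ℝ)⁻¹ * Real.log (s - 1)| ≤ C := by
    intro a
    by_cases ha : a ∈ A
    · obtain ⟨C, hC⟩ := exists_abs_primeZetaSum_add_log_le (hA a ha)
      exact ⟨C, fun _ => hC⟩
    · exact ⟨0, fun h => absurd h ha⟩
  choose C hC using hex
  refine ⟨E.card + ∑ a ∈ A, C a, fun s hs => ?_⟩
  have h1 := abs_primeZetaSum_sub_le (T' := {q | (q : ZMod M) ∈ A}) E h hs.1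
  have h2 : |primeZetaSum {q | (q : ZMod M) ∈ A} s + A.card / (M.totient : ℝ) * Real.log (s - 1)|
      ≤ ∑ a ∈ A, C a := by
    have : primeZetaSum {q | (q : ZMod M) ∈ A} s + A.card / (M.totient : ℝ) * Real.log (s - 1) =
        ∑ a ∈ A, (primeZetaSum {q | (q : ZMod M) = a} s +
          (M.totient : ℝ)⁻¹ * Real.log (s - 1)) := by
      rw [primeZetaSum_mem_finset A hs.1, Finset.sum_add_distrib, Finset.sum_const, nsmul_eq_mul]
      ring
    rw [this]
    exact (Finset.abs_sum_le_sum_abs _ _).trans (Finset.sum_le_sum fun a ha => hC a ha s hs)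
  rw [abs_le] at h1 h2 ⊢
  constructor <;> linarith [h1.1, h1.2, h2.1, h2.2]

open Filter Topology in
-- Divide both sums by `-log (s - 1)`, which tends to infinity as `s → 1⁺`, so that the bounded
-- errors disappear.
theorem tendsto_primeZetaSum_div {T T' : Set ℕ} {δ C C' : ℝ}
    (h : ∀ s ∈ Set.Ioc (1 : ℝ) 2, |primeZetaSum T s + δ * Real.log (s - 1)| ≤ C)
    (h' : ∀ s ∈ Set.Ioc (1 : ℝ) 2, |primeZetaSum T' s + Real.log (s - 1)| ≤ C') :
    Tendsto (fun s => primeZetaSum T s / primeZetaSum T' s) (𝓝[>] 1) (𝓝 δ) := by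
  have hmem : ∀ᶠ s : ℝ in 𝓝[>] 1, s ∈ Set.Ioc (1 : ℝ) 2 := Ioc_mem_nhdsGT one_lt_two
  have hlog : Tendsto (fun s : ℝ => -Real.log (s - 1)) (𝓝[>] 1) atTop := by
    refine tendsto_neg_atBot_atTop.comp (Real.tendsto_log_nhdsGT_zero.comp ?_)
    refine tendsto_nhdsWithin_iff.2 ⟨?_, ?_⟩
    · have : Tendsto (fun s : ℝ => s - 1) (𝓝 1) (𝓝 (1 - 1)) := tendsto_id.sub_const 1
      rw [sub_self] at this
      exact this.mono_left nhdsWithin_le_nhds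
    · filter_upwards [self_mem_nhdsWithin] with s hs
      exact sub_pos.2 (Set.mem_Ioi.1 hs)
  have hinv := hlog.inv_tendsto_atTop
  have hratio : ∀ (U : Set ℕ) (ε B : ℝ),
      (∀ s ∈ Set.Ioc (1 : ℝ) 2, |primeZetaSum U s + ε * Real.log (s - 1)| ≤ B) →
      Tendsto (fun s => primeZetaSum U s * (-Real.log (s - 1))⁻¹) (𝓝[>] 1) (𝓝 ε) := by
    intro U ε B hU
    have hb : Tendsto (fun s : ℝ => (primeZetaSum U s + ε * Real.log (s - 1)) *
        (-Real.log (s - 1))⁻¹) (𝓝[>] 1) (𝓝 0) := by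
      refine bdd_le_mul_tendsto_zero' B ?_ hinv
      filter_upwards [hmem] with s hs using hU s hs
    have hb' := hb.add_const ε
    rw [zero_add] at hb'
    refine hb'.congr' ?_
    filter_upwards [hlog.eventually_gt_atTop 0] with s hs
    have : Real.log (s - 1) ≠ 0 := by
      intro h0
      rw [h0] at hs
      simp at hs
    field_simp
    ring
  have h1 := hratio T δ C h
  have h2 := hratio T' 1 C' (by simpa using h')
  have h3 := h1.div h2 one_ne_zero
  rw [div_one] at h3
  refine h3.congr' ?_
  filter_upwards [hlog.eventually_gt_atTop 0] with s hs
  simp only [Pi.div_apply]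
  rw [mul_div_mul_right _ _ (inv_ne_zero hs.ne')]

/-! ### Passage from prime ideals of `𝓞 ℚ` to prime numbers -/

open IsDedekindDomain in
theorem absNorm_eq_primesEquiv (v : HeightOneSpectrum (𝓞 ℚ)) :
    Ideal.absNorm v.asIdeal = (Rat.HeightOneSpectrum.primesEquiv v : ℕ) := by
  have h := Rat.HeightOneSpectrum.span_natGenerator v
  have h1 : Ideal.absNorm v.asIdeal =
      Ideal.absNorm (v.asIdeal.map (Rat.IsIntegralClosure.intEquiv (𝓞 ℚ))) := by
    simp only [Ideal.absNorm_apply, Submodule.cardQuot_apply]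
    exact Nat.card_congr (Ideal.quotientEquiv _ _ (Rat.IsIntegralClosure.intEquiv (𝓞 ℚ)) rfl).toEquiv
  rw [h1, ← h, Ideal.absNorm_span_singleton, Algebra.norm_self, MonoidHom.id_apply,
    Int.natAbs_natCast]
  rfl

open IsDedekindDomain in
theorem primeIdealZetaSum_eq_primeZetaSum (T : Set ℕ) (s : ℝ) :
    NumberField.Set.primeIdealZetaSum
      {𝔮 : HeightOneSpectrum (𝓞 ℚ) | Ideal.absNorm 𝔮.asIdeal ∈ T} s = primeZetaSum T s := by
  rw [NumberField.Set.primeIdealZetaSum_def, primeZetaSum,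
    tsum_subtype {𝔮 : HeightOneSpectrum (𝓞 ℚ) | Ideal.absNorm 𝔮.asIdeal ∈ T}
      (fun 𝔮 => (Ideal.absNorm 𝔮.asIdeal : ℝ) ^ (-s)),
    ← tsum_subtype_eq_of_support_subset (s := {q : ℕ | q.Prime})
      (Set.support_indicator_subset.trans fun q hq => hq.1)]
  refine Eq.trans ?_ ((Rat.HeightOneSpectrum.primesEquiv (R := 𝓞 ℚ)).tsum_eq fun q : Nat.Primes =>
    {q | q.Prime ∧ q ∈ T}.indicator (fun n : ℕ => (n : ℝ) ^ (-s)) q)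
  refine tsum_congr fun v => ?_
  classical
  simp only [Set.indicator_apply, Set.mem_ofPred_eq, absNorm_eq_primesEquiv,
    (Rat.HeightOneSpectrum.primesEquiv v).2, true_and]

theorem hasPrimeDensity_of_residueClasses {M : ℕ} [NeZero M] {T : Set ℕ}
    (A : Finset (ZMod M)) (hA : ∀ a ∈ A, IsUnit a) (E : Finset ℕ)
    (h : ∀ q : ℕ, q.Prime → q ∉ E → (q ∈ T ↔ (q : ZMod M) ∈ A)) :
    HasPrimeDensity T (A.card / (M.totient : ℝ)) := by
  obtain ⟨C, hC⟩ := exists_abs_primeZetaSum_add_card_mul_log_le A hA E h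
  -- The sum over all primes is the case of modulus `1`, where the only class `0` is a unit.
  obtain ⟨C', hC'⟩ := exists_abs_primeZetaSum_add_card_mul_log_le (M := 1) (T := Set.univ)
    {0} (fun a _ => isUnit_of_subsingleton a) ∅
    (fun q _ _ => by simp [Subsingleton.elim (q : ZMod 1) 0])
  have := tendsto_primeZetaSum_div hC (by simpa using hC')
  refine this.congr fun s => ?_
  rw [primeIdealZetaSum_eq_primeZetaSum, ← primeIdealZetaSum_eq_primeZetaSum Set.univ]
  simp

/-! ### Counting the soluble classes modulo `p ^ 2` -/

section Count

variable {p r : ℕ} [Fact p.Prime]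

open Classical in
/-- The unit classes `a ≢ 1 (mod p)` modulo `p ^ 2` for which `x ^ p + a y ^ p + r z ^ p` has
a nontrivial zero over `ℚ_p`. -/
noncomputable def solubleClasses (p r : ℕ) [Fact p.Prime] : Finset (ZMod (p ^ 2)) :=
  Finset.univ.filter fun a => IsUnit a ∧ ZMod.castHom (dvd_pow_self p two_ne_zero) (ZMod p) a ≠ 1 ∧
    FermatSoluble p (1 : ℚ_[p]) (a.val : ℚ_[p]) r

theorem isUnit_natCast_zmod_sq {n : ℕ} (hn : ¬ p ∣ n) : IsUnit (n : ZMod (p ^ 2)) :=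
  (ZMod.isUnit_iff_coprime n (p ^ 2)).2
    (((Fact.out : p.Prime).coprime_iff_not_dvd.2 hn).symm.pow_right 2)

/-- The definition tests the representative `val`; `FermatSoluble.congr_mod_sq` transfers solubility
to any other one. -/
theorem natCast_mem_solubleClasses_iff (hodd : Odd p) {q : ℕ} (hq : ¬ p ∣ q) :
    (q : ZMod (p ^ 2)) ∈ solubleClasses p r ↔
      ¬ q ≡ 1 [MOD p] ∧ FermatSoluble p (1 : ℚ_[p]) q r := by
  have hval : ((q : ZMod (p ^ 2)).val : ZMod (p ^ 2)) = q := ZMod.natCast_zmod_val _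
  have hu := isUnit_natCast_zmod_sq hq
  have hq' : ¬ p ∣ (q : ZMod (p ^ 2)).val := by
    rw [ZMod.val_natCast, Nat.dvd_mod_iff (dvd_pow_self p two_ne_zero)]
    exact hq
  have hone : ZMod.castHom (dvd_pow_self p two_ne_zero) (ZMod p) (q : ZMod (p ^ 2)) = 1 ↔
      q ≡ 1 [MOD p] := by
    rw [map_natCast, ← ZMod.natCast_eq_natCast_iff, Nat.cast_one]
  simp only [solubleClasses, Finset.mem_filter, Finset.mem_univ, true_and, hu, ne_eq, hone]
  exact and_congr_right fun _ => ⟨fun h => h.congr_mod_sq hodd hq' hval,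
    fun h => h.congr_mod_sq hodd hq hval.symm⟩

theorem pow_mul_pred_eq_one {t : ℕ} (ht : ¬ p ∣ t) :
    ((t : ZMod (p ^ 2)) ^ p) ^ (p - 1) = 1 := by
  obtain ⟨u, hu⟩ := isUnit_natCast_zmod_sq ht
  have h := ZMod.pow_totient u
  rw [Nat.totient_prime_pow Fact.out two_pos, show 2 - 1 = 1 from rfl, pow_one] at h
  rw [← hu, ← pow_mul, ← Units.val_pow_eq_pow_val, h, Units.val_one]

/-- Two families of `p - 2` classes: `t ^ p`, with the point `(t : -1 : 0)`, and `r t ^ p`, with the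
point `(0 : -1 : t)`. They reduce to `t` and `-t` mod `p`, so each is injective in `t`, and the
condition of not being `1` mod `p` excludes one nonzero `t` from each. -/
theorem two_mul_sub_two_le_card_solubleClasses (hp5 : 5 ≤ p) (hr1 : (r : ZMod p) = -1)
    (hrp : ¬ r ^ (p - 1) ≡ 1 [MOD p ^ 2]) : 2 * (p - 2) ≤ (solubleClasses p r).card := by
  classical
  have hp : p.Prime := Fact.out
  have hodd : Odd p := hp.odd_of_ne_two (by omega)
  have hdvd : ∀ t : ZMod p, t ≠ 0 → ¬ p ∣ t.val := fun t ht h => ht (by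
    rw [← ZMod.natCast_zmod_val t]
    exact (ZMod.natCast_eq_zero_iff _ _).2 h)
  have hrdvd : ¬ p ∣ r := by
    rw [← ZMod.natCast_eq_zero_iff, hr1]
    simp
  let c : ZMod (p ^ 2) →+* ZMod p := ZMod.castHom (dvd_pow_self p two_ne_zero) (ZMod p)
  let f : ZMod p → ZMod (p ^ 2) := fun t => (t.val : ZMod (p ^ 2)) ^ p
  let g : ZMod p → ZMod (p ^ 2) := fun t => r * (t.val : ZMod (p ^ 2)) ^ p
  have hf : ∀ t, c (f t) = t := fun t => by
    simp only [f, map_pow, map_natCast, ZMod.natCast_zmod_val, ZMod.pow_card]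
  have hg : ∀ t, c (g t) = -t := fun t => by
    simp only [g, map_mul, map_pow, map_natCast, ZMod.natCast_zmod_val, ZMod.pow_card, hr1]
    ring
  have hfinj : Function.Injective f := fun s t h => by rw [← hf s, ← hf t, h]
  have hginj : Function.Injective g := fun s t h => neg_injective (by rw [← hg s, ← hg t, h])
  set F := ((Finset.univ.erase (0 : ZMod p)).erase 1).image f
  set G := ((Finset.univ.erase (0 : ZMod p)).erase (-1)).image g
  have hFcard : F.card = p - 2 := by
    rw [Finset.card_image_of_injective _ hfinj, Finset.card_erase_of_mem (by simp),
      Finset.card_erase_of_mem (by simp), Finset.card_univ, ZMod.card]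
    omega
  have hGcard : G.card = p - 2 := by
    rw [Finset.card_image_of_injective _ hginj, Finset.card_erase_of_mem (by simp),
      Finset.card_erase_of_mem (by simp), Finset.card_univ, ZMod.card]
    omega
  have hdisj : Disjoint F G := by
    rw [Finset.disjoint_left]
    intro a haF haG
    simp only [F, G, Finset.mem_image, Finset.mem_erase, Finset.mem_univ, and_true] at haF haG
    obtain ⟨s, ⟨-, hs⟩, rfl⟩ := haF
    obtain ⟨t, ⟨-, ht⟩, h⟩ := haG
    -- Raising to the power `p - 1` kills `p`-th powers of units, so a common class would force `r ^
    -- (p - 1) = 1` mod `p ^ 2`.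
    have h1 := congrArg (· ^ (p - 1)) h
    simp only [f, g] at h1
    rw [mul_pow, pow_mul_pred_eq_one (hdvd s hs), pow_mul_pred_eq_one (hdvd t ht), mul_one] at h1
    refine hrp ((ZMod.natCast_eq_natCast_iff _ _ _).1 ?_)
    push_cast
    exact h1
  have hFsub : F ⊆ solubleClasses p r := by
    intro a ha
    simp only [F, Finset.mem_image, Finset.mem_erase, Finset.mem_univ, and_true] at ha
    obtain ⟨t, ⟨ht1, ht0⟩, rfl⟩ := ha
    have h1 := (natCast_mem_solubleClasses_iff (r := r) hodd (q := t.val ^ p)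
      fun h => hdvd t ht0 (hp.dvd_of_dvd_pow h)).2 ⟨?_, (t.val : ℚ_[p]), -1, 0, by simp, ?_⟩
    · rwa [Nat.cast_pow] at h1
    · rw [← ZMod.natCast_eq_natCast_iff]
      simpa using ht1
    · simp [hodd.neg_one_pow, hp.ne_zero]
  have hGsub : G ⊆ solubleClasses p r := by
    intro a ha
    simp only [G, Finset.mem_image, Finset.mem_erase, Finset.mem_univ, and_true] at ha
    obtain ⟨t, ⟨ht1, ht0⟩, rfl⟩ := ha
    have h1 := (natCast_mem_solubleClasses_iff (r := r) hodd (q := r * t.val ^ p)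
      fun h => (hp.dvd_mul.1 h).elim hrdvd fun h => hdvd t ht0 (hp.dvd_of_dvd_pow h)).2
      ⟨?_, 0, -1, (t.val : ℚ_[p]), by simp, ?_⟩
    · rwa [Nat.cast_mul, Nat.cast_pow] at h1
    · rw [← ZMod.natCast_eq_natCast_iff]
      simp only [Nat.cast_mul, hr1, Nat.cast_pow, ZMod.natCast_zmod_val, ZMod.pow_card,
        Nat.cast_one]
      intro h
      exact ht1 (by rw [← h]; ring)
    · push_cast
      rw [hodd.neg_one_pow, zero_pow hp.ne_zero]
      ring
  calc 2 * (p - 2) = (F ∪ G).card := by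
        rw [Finset.card_union_of_disjoint hdisj, hFcard, hGcard, two_mul]
    _ ≤ _ := Finset.card_le_card (Finset.union_subset hFsub hGsub)

end Count

theorem proposition1 (p r : ℕ) (hp : p.Prime) (hp5 : 5 ≤ p) (hr : r.Prime)
    (hrN : (r : ℤ) ≡ -1 [ZMOD (exceptionalModulus p : ℤ)])
    (hrp : ¬ r ^ (p - 1) ≡ 1 [MOD p ^ 2]) :
    ∃ d : ℝ, HasPrimeDensity (unobstructedPrimes p r) d ∧
      2 * ((p : ℝ) - 2) / ((p : ℝ) * ((p : ℝ) - 1)) ≤ d := by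
  have : Fact p.Prime := ⟨hp⟩
  have hodd : Odd p := hp.odd_of_ne_two (by omega)
  have hr1 : (r : ZMod p) = -1 := by
    have h2 : (r : ℤ) ≡ -1 [ZMOD (p : ℤ)] :=
      hrN.of_dvd (by rw [exceptionalModulus]; push_cast; exact dvd_mul_right _ _)
    have := (ZMod.intCast_eq_intCast_iff _ _ _).2 h2
    simpa using this
  -- Two primes are discarded: `p`, whose class is not a unit, and `r`, where the argument at `ℓ =
  -- q` breaks down.
  refine ⟨(solubleClasses p r).card / ((p ^ 2).totient : ℝ),
    hasPrimeDensity_of_residueClasses (solubleClasses p r) (fun a ha => ?_) {p, r}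
      fun q hq hE => ?_, ?_⟩
  · simp only [solubleClasses, Finset.mem_filter] at ha
    exact ha.2.1
  · simp only [Finset.mem_insert, Finset.mem_singleton, not_or] at hE
    have hpq : ¬ p ∣ q := fun h => hE.1 ((Nat.prime_dvd_prime_iff_eq hp hq).1 h).symm
    have hiff : ∀ (ℓ : ℕ) [Fact ℓ.Prime], ¬ HasLocalObstruction p 1 q r ℓ ↔
        FermatSoluble p (1 : ℚ_[ℓ]) q r := fun ℓ _ => by
      simpa using not_hasLocalObstruction_iff p 1 q r ℓ
    rw [natCast_mem_solubleClasses_iff hodd hpq]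
    constructor
    · rintro ⟨-, h1, h⟩
      exact ⟨h1, (hiff p).1 (h p)⟩
    · rintro ⟨h1, h⟩
      refine ⟨hq, h1, fun ℓ _ => (hiff ℓ).2 ?_⟩
      rcases eq_or_ne ℓ p with rfl | hℓ
      · exact h
      · exact fermatSoluble_of_ne hp hp5 hr hrN hq h1 hE.2 hℓ
  · have hcard := two_mul_sub_two_le_card_solubleClasses hp5 hr1 hrp
    have hp5' : (5 : ℝ) ≤ p := by exact_mod_cast hp5
    have hcard' : 2 * ((p : ℝ) - 2) ≤ (solubleClasses p r).card := by
      have : ((2 * (p - 2) : ℕ) : ℝ) ≤ (solubleClasses p r).card := by exact_mod_cast hcard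
      rwa [Nat.cast_mul, Nat.cast_sub (by omega)] at this
    rw [Nat.totient_prime_pow hp two_pos, show 2 - 1 = 1 from rfl, pow_one, Nat.cast_mul, Nat.cast_sub hp.one_le,
      Nat.cast_one]
    have : 0 ≤ (p : ℝ) * ((p : ℝ) - 1) := mul_nonneg (by linarith) (by linarith)
    gcongr
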